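/- Let $S(n,k)$ denote the Stirling numbers of the second kind, and for $l\in\mathbb Z$ let the higher order Bernoulli polynomials $B_n^{(l)}(x)\in\mathbb Q[x]$ be defined by $$\Big(\frac{t}{e^t-1}\Big)^{l}e^{tx}=\sum_{n\ge 0}B_n^{(l)}(x)\frac{t^n}{n!}.$$ Let $p$ be a prime, let $\nu_p$ be the $p$-adic valuation (with $\nu_p(0)=\infty$), and call the exponent of the highest power of $p$ in the denominator of any coefficient of a polynomial $f\in\mathbb Q[x]$ the maximum pole of $f$ (at $p$). For $0\le k\le n$ let $M$ be the maximum pole of $B_{n-k}^{(-k)}(x)$, and for $1\le k\le n$ let $M'$ be the maximum pole of $B_{n-k}^{(-k+1)}(x)$. The number $S(n,k)$ is called an almost minimum zero case (AMZC) if $\nu_p(S(n,k))=\nu_p\big(\binom nk\big)-M$, and, when $k\ge 1$, a shifted almost minimum zero case (SAMZC) if $\nu_p(S(n,k))=\nu_p\big(\binom{n-1}{k-1}\big)-M'$. **Theorem.** Let $p$ be any prime (odd or even). (a) Let $0\le k\le n$ with $\nu_p(k)\le\nu_p(n)$ and $p-1\mid n-k$. Then $S(n,k)$ is an AMZC if and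 only if $S(n+1,k+1)$ is a SAMZC, and if $S(n,k)$ is an AMZC, then $\nu_p(S(n+1,k+1))=\nu_p(S(n,k))$. (b) Let $1\le k\le n$ with $\nu_p(k-1)\le\nu_p(n-1)$ and $p-1\mid n-k$. Then $S(n-1,k-1)$ is an AMZC if and only if $S(n,k)$ is a SAMZC, and if $S(n-1,k-1)$ is an AMZC, then $\nu_p(S(n,k))=\nu_p(S(n-1,k-1))$. -/

import Mathlib

namespace StirlingCases

/-- The power series `(e^t - 1) / t = ∑ tⁿ / (n + 1)!` over `ℚ`. -/
noncomputable def expSubOneDiv : PowerSeries ℚ :=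
  PowerSeries.mk fun n => ((n + 1).factorial : ℚ)⁻¹

theorem X_mul_expSubOneDiv :
    (PowerSeries.X : PowerSeries ℚ) * expSubOneDiv = PowerSeries.exp ℚ - 1 := by
  ext n
  cases n with
  | zero => simp
  | succ n =>
    simp [PowerSeries.coeff_succ_X_mul, expSubOneDiv, PowerSeries.coeff_exp,
      PowerSeries.coeff_one]

theorem constantCoeff_expSubOneDiv :
    PowerSeries.constantCoeff expSubOneDiv = 1 := by
  simp [expSubOneDiv]

/-- The power series `(t / (e^t - 1)) ^ l` over `ℚ`, for an arbitrary integer exponent `l`. -/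
noncomputable def toddPow (l : ℤ) : PowerSeries ℚ :=
  if 0 ≤ l then expSubOneDiv⁻¹ ^ l.toNat else expSubOneDiv ^ (-l).toNat

/-- The higher order Bernoulli polynomial `B_n^{(l)}(x)`, defined by
`(t / (e^t - 1)) ^ l * e^{t x} = ∑ₙ B_n^{(l)}(x) tⁿ / n!` in `ℚ[x]⟦t⟧`. -/
noncomputable def higherBernoulli (l : ℤ) (n : ℕ) : Polynomial ℚ :=
  (n.factorial : ℚ) •
    PowerSeries.coeff n
      (PowerSeries.map Polynomial.C (toddPow l) *
        PowerSeries.rescale Polynomial.X (PowerSeries.exp (Polynomial ℚ)))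

/-- The maximum pole of a rational polynomial at `p`: the exponent of the highest power of `p`
occurring in the denominator of a coefficient. -/
noncomputable def maxPole (p : ℕ) (f : Polynomial ℚ) : ℕ :=
  f.support.sup fun i => padicValNat p (f.coeff i).den

/-- The almost minimum zero estimate for `ν_p(S(n,k))`. -/
noncomputable def amzEstimate (p n k : ℕ) : ℤ :=
  (padicValNat p (n.choose k) : ℤ) - maxPole p (higherBernoulli (-(k : ℤ)) (n - k))

/-- The shifted almost minimum zero estimate for `ν_p(S(n,k))`, for `1 ≤ k ≤ n`. -/
noncomputable def samzEstimate (p n k : ℕ) : ℤ :=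
  (padicValNat p ((n - 1).choose (k - 1)) : ℤ) -
    maxPole p (higherBernoulli (-(k : ℤ) + 1) (n - k))

/-- `S(n,k)` is an almost minimum zero case: `ν_p(S(n,k))` is equal to the almost minimum zero
estimate (never so when `S(n,k) = 0`, where the valuation is infinite). -/
def IsAMZC (p n k : ℕ) : Prop :=
  Nat.stirlingSecond n k ≠ 0 ∧ (padicValNat p (Nat.stirlingSecond n k) : ℤ) = amzEstimate p n k

/-- `S(n,k)` is a shifted almost minimum zero case: `ν_p(S(n,k))` is equal to the shifted almost
minimum zero estimate. -/
def IsSAMZC (p n k : ℕ) : Prop :=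
  Nat.stirlingSecond n k ≠ 0 ∧ (padicValNat p (Nat.stirlingSecond n k) : ℤ) = samzEstimate p n k

end StirlingCases

open Polynomial

namespace StirlingCases

/-! Write G_{n,k} = Δᵏxⁿ/k!, a polynomial over ℤ. It equals binom(n,k)·B_{n-k}^{(-k)}(x) and takes
the values S(n,k) at 0 and S(n+1,k+1) at 1. The two estimates in the theorem are the same number A,
and p^A divides G_{n,k} (`pow_dvd_coeff_stirlingPoly`). With G_{n,k} = p^A·F it is therefore enough
that F(1) ≡ F(0) mod p (`pow_succ_dvd_stirlingSecond_sub`): then p^A exactly divides both Stirling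
numbers or neither.

In fact F mod p is constant as a function on ℤ/p. Let W_b be the sum of the translates by 0, ...,
b-1. Then (W_bᵏF)(bx) = bⁿF(x). If the moments ∑ xⁱF(x) vanish for i < j, translation fixes the j-th
moment m_j, so W_bᵏ multiplies it by bᵏ, while the formula gives b^{n+j}. For b a primitive root,
p-1 ∣ n-k turns this into (b^j - 1)·m_j = 0, so m_j = 0 for 0 < j < p-1. Once m_0 = 0 as well, F is
constant (`eval_eq_eval_of_multiplication`).

The condition ν_p(k) ≤ ν_p(n) serves to give m_0 = 0 (`moment_zero_eq_zero`): it makes n/k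
p-integral, and W_pF is then computed from G_{n-1,k-1} by a Taylor expansion with step p. The prime
2 needs an extra argument, because p/2 is then a unit. -/

/-- The polynomial `Δᵏ xⁿ / k!`, given by its recursion. -/
noncomputable def stirlingPoly (R : Type*) [CommRing R] : ℕ → ℕ → R[X]
  | n, 0 => X ^ n
  | 0, _ + 1 => 0
  | n + 1, k + 1 => X * stirlingPoly R n (k + 1) + taylor 1 (stirlingPoly R n k)

/-! ### Recursions and special values of Δᵏxⁿ/k! -/

section Basic

variable {R : Type*} [CommRing R]

theorem stirlingPoly_zero_right (n : ℕ) : stirlingPoly R n 0 = X ^ n := by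
  cases n <;> simp [stirlingPoly]

theorem stirlingPoly_succ_succ (n k : ℕ) :
    stirlingPoly R (n + 1) (k + 1) =
      X * stirlingPoly R n (k + 1) + taylor 1 (stirlingPoly R n k) := by
  rw [stirlingPoly]

theorem map_stirlingPoly {S : Type*} [CommRing S] (f : R →+* S) (n k : ℕ) :
    (stirlingPoly R n k).map f = stirlingPoly S n k := by
  induction n generalizing k with
  | zero => cases k <;> simp [stirlingPoly]
  | succ n ih => cases k <;> simp [stirlingPoly, ih, Polynomial.map_taylor]

/-- This identifies the division-free recursion of the definition with iterated differences; the
definition itself makes sense over any commutative ring. -/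
theorem succ_mul_stirlingPoly_succ (n k : ℕ) :
    ((k : R[X]) + 1) * stirlingPoly R n (k + 1) =
      taylor 1 (stirlingPoly R n k) - stirlingPoly R n k := by
  induction n generalizing k with
  | zero => cases k <;> simp [stirlingPoly]
  | succ n ih =>
    rw [stirlingPoly_succ_succ, mul_add, mul_left_comm, ih]
    cases k with
    | zero =>
      simp only [stirlingPoly_zero_right, pow_succ, taylor_mul, taylor_X]
      simp
      ring
    | succ k =>
      have h := congrArg (taylor (1 : R)) (ih k)
      have hc : taylor (1 : R) (k : R[X]) = (k : R[X]) := by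
        rw [← C_eq_natCast, taylor_C]
      simp only [map_sub, taylor_mul, map_add, hc, taylor_one, C_1] at h
      rw [stirlingPoly_succ_succ, map_add, taylor_mul, taylor_X]
      push_cast
      simp only [C_1]
      linear_combination h

theorem derivative_stirlingPoly_succ (n k : ℕ) :
    derivative (stirlingPoly R (n + 1) k) = ((n : R[X]) + 1) * stirlingPoly R n k := by
  have ht : ∀ f : R[X], derivative (taylor 1 f) = taylor 1 (derivative f) := fun f => by
    simp [taylor_apply, derivative_comp]
  induction n generalizing k with
  | zero =>
    rcases k with _ | _ | k <;> simp [stirlingPoly]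
  | succ n ih =>
    cases k with
    | zero => simp [stirlingPoly_zero_right]
    | succ k =>
      have hc : taylor (1 : R) (n : R[X]) = (n : R[X]) := by
        rw [← C_eq_natCast, taylor_C]
      rw [stirlingPoly_succ_succ, derivative_add, derivative_mul, ht, ih, ih, derivative_X,
        taylor_mul, map_add, hc, taylor_one, C_1, stirlingPoly_succ_succ]
      push_cast
      ring

theorem eval_zero_stirlingPoly (n k : ℕ) :
    (stirlingPoly R n k).eval 0 = Nat.stirlingSecond n k := by
  induction n generalizing k with
  | zero => cases k <;> simp [stirlingPoly]
  | succ n ih =>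
    cases k with
    | zero => simp [stirlingPoly]
    | succ k =>
      have h := congrArg (eval (0 : R)) (succ_mul_stirlingPoly_succ (R := R) n k)
      simp only [eval_mul, eval_add, eval_natCast, eval_one, eval_sub, taylor_eval, ih] at h
      rw [stirlingPoly_succ_succ, Nat.stirlingSecond_succ_succ]
      simp only [eval_add, eval_mul, eval_X, taylor_eval]
      push_cast
      linear_combination -h

theorem eval_one_stirlingPoly (n k : ℕ) :
    (stirlingPoly R n k).eval 1 = Nat.stirlingSecond (n + 1) (k + 1) := by
  rw [← eval_zero_stirlingPoly, stirlingPoly_succ_succ]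
  simp [taylor_eval]

theorem natDegree_stirlingPoly_le (n k : ℕ) : (stirlingPoly R n k).natDegree ≤ n := by
  induction n generalizing k with
  | zero => cases k <;> simp [stirlingPoly]
  | succ n ih =>
    cases k with
    | zero => simpa [stirlingPoly] using natDegree_X_pow_le (n + 1)
    | succ k =>
      rw [stirlingPoly_succ_succ]
      refine natDegree_add_le_of_degree_le ?_ ?_
      · exact (natDegree_mul_le.trans (add_le_add natDegree_X_le (ih _))).trans (by omega)
      · rw [natDegree_taylor]
        exact (ih k).trans (by omega)

end Basic

/-! ### Comparison with the higher order Bernoulli polynomials -/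

/-- Multiplying e^{(x+c)t} by e^t - 1 takes a difference in x. The shift `c` is carried along
because each induction step needs it at both c and c + 1. -/
theorem coeff_expSubOne_pow_mul_rescale (n k : ℕ) (c : ℚ) :
    (n.factorial : ℚ[X]) * PowerSeries.coeff n
      ((PowerSeries.exp ℚ[X] - 1) ^ k *
        PowerSeries.rescale (X + C c) (PowerSeries.exp ℚ[X])) =
      (k.factorial : ℚ[X]) * taylor c (stirlingPoly ℚ n k) := by
  induction k generalizing c with
  | zero =>
    have hn : (n.factorial : ℚ[X]) * C ((n.factorial : ℚ)⁻¹) = 1 := by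
      rw [← C_eq_natCast, ← C_mul, mul_inv_cancel₀ (by positivity), C_1]
    simp only [pow_zero, one_mul, PowerSeries.coeff_rescale, PowerSeries.coeff_exp,
      stirlingPoly_zero_right, taylor_pow, taylor_X, Nat.factorial_zero, Nat.cast_one,
      Polynomial.algebraMap_eq, one_div]
    linear_combination (X + C c) ^ n * hn
  | succ k ih =>
    have hE : (PowerSeries.exp ℚ[X] - 1) *
        PowerSeries.rescale (X + C c) (PowerSeries.exp ℚ[X]) =
        PowerSeries.rescale (X + C (c + 1)) (PowerSeries.exp ℚ[X]) -
          PowerSeries.rescale (X + C c) (PowerSeries.exp ℚ[X]) := by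
      have h := PowerSeries.exp_mul_exp_eq_exp_add (1 : ℚ[X]) (X + C c)
      rw [PowerSeries.rescale_one, RingHom.id_apply] at h
      rw [sub_mul, one_mul, h, C_add, C_1, add_comm (1 : ℚ[X]), add_assoc]
    have hs := congrArg (taylor c) (succ_mul_stirlingPoly_succ (R := ℚ) n k)
    have hc : taylor c (k : ℚ[X]) = (k : ℚ[X]) := by rw [← C_eq_natCast, taylor_C]
    rw [map_sub, taylor_mul, map_add, hc, taylor_one, C_1, taylor_taylor] at hs
    rw [pow_succ, mul_assoc, hE, mul_sub, map_sub, mul_sub, ih, ih, Nat.factorial_succ]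
    push_cast
    linear_combination -(k.factorial : ℚ[X]) * hs

/-- Compare coefficients of tⁿ after factoring (e^t - 1)ᵏ = tᵏ·((e^t - 1)/t)ᵏ. -/
theorem choose_mul_higherBernoulli {n k : ℕ} (hk : k ≤ n) :
    (n.choose k : ℚ[X]) * higherBernoulli (-(k : ℤ)) (n - k) = stirlingPoly ℚ n k := by
  have ht : toddPow (-(k : ℤ)) = expSubOneDiv ^ k := by
    unfold toddPow
    split_ifs with h
    · obtain rfl : k = 0 := by omega
      simp
    · simp
  have h := coeff_expSubOne_pow_mul_rescale n k 0
  have hX : (PowerSeries.exp ℚ[X] - 1) ^ k =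
      PowerSeries.X ^ k * PowerSeries.map C (expSubOneDiv ^ k) := by
    have := congrArg (PowerSeries.map (C : ℚ →+* ℚ[X])) X_mul_expSubOneDiv
    rw [map_mul, PowerSeries.map_X, map_sub, PowerSeries.map_exp, map_one] at this
    rw [map_pow, ← mul_pow, this]
  obtain ⟨m, rfl⟩ := Nat.exists_eq_add_of_le hk
  rw [hX, mul_assoc, add_comm k m, PowerSeries.coeff_X_pow_mul, C_0, add_zero, taylor_zero] at h
  have hf := Nat.add_choose_mul_factorial_mul_factorial m k
  have hk0 : (k.factorial : ℚ[X]) ≠ 0 := by exact_mod_cast k.factorial_ne_zero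
  apply mul_left_cancel₀ hk0
  rw [add_comm k m, ← h, Nat.add_sub_cancel, higherBernoulli, ht, ← hf,
    smul_eq_C_mul, C_eq_natCast]
  push_cast
  ring

/-! ### The multiplication formula -/

/-- The operator `f(x) ↦ f(x) + f(x + 1) + ⋯ + f(x + b - 1)`. -/
noncomputable def windowSum (R : Type*) [CommRing R] (b : ℕ) : R[X] →ₗ[R] R[X] :=
  ∑ i ∈ Finset.range b, taylor (i : R)

theorem windowSum_apply {R : Type*} [CommRing R] (b : ℕ) (f : R[X]) :
    windowSum R b f = ∑ i ∈ Finset.range b, taylor (i : R) f := by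
  simp [windowSum, LinearMap.sum_apply]

theorem windowSum_taylor_one_sub {R : Type*} [CommRing R] (b : ℕ) (f : R[X]) :
    windowSum R b (taylor 1 f - f) = taylor (b : R) f - f := by
  rw [windowSum_apply]
  simp only [map_sub, taylor_taylor]
  have := Finset.sum_range_sub (fun i : ℕ => taylor (i : R) f) b
  simpa using this

theorem windowSum_taylor {R : Type*} [CommRing R] (b : ℕ) (c : R) (f : R[X]) :
    windowSum R b (taylor c f) = taylor c (windowSum R b f) := by
  simp only [windowSum_apply, map_sum, taylor_taylor, add_comm c]

theorem windowSum_pow_taylor {R : Type*} [CommRing R] (b k : ℕ) (c : R) (f : R[X]) :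
    (windowSum R b ^ k) (taylor c f) = taylor c ((windowSum R b ^ k) f) := by
  induction k generalizing f with
  | zero => rfl
  | succ k ih => rw [pow_succ, Module.End.mul_apply, Module.End.mul_apply, windowSum_taylor, ih]

theorem map_windowSum_pow {R S : Type*} [CommRing R] [CommRing S] (φ : R →+* S) (b k : ℕ)
    (f : R[X]) : ((windowSum R b ^ k) f).map φ = (windowSum S b ^ k) (f.map φ) := by
  induction k generalizing f with
  | zero => rfl
  | succ k ih =>
    rw [pow_succ, pow_succ, Module.End.mul_apply, Module.End.mul_apply, ih]
    simp [windowSum_apply, Polynomial.map_sum, Polynomial.map_taylor]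

/-- One factor `windowSum` turns the unit difference into a difference of step b, and a step b at bx
is a unit step at x. -/
theorem eval_windowSum_pow_stirlingPoly {R : Type*} [CommRing R] [IsDomain R] [CharZero R]
    (b n k : ℕ) (x : R) :
    ((windowSum R b ^ k) (stirlingPoly R n k)).eval (b * x) =
      b ^ n * (stirlingPoly R n k).eval x := by
  induction k generalizing x with
  | zero => simp [stirlingPoly_zero_right, mul_pow]
  | succ k ih =>
    have hk : ((k : R) + 1) ≠ 0 := by exact_mod_cast k.succ_ne_zero
    have hG : ((k : R) + 1) • stirlingPoly R n (k + 1) =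
        taylor 1 (stirlingPoly R n k) - stirlingPoly R n k := by
      rw [← succ_mul_stirlingPoly_succ, smul_eq_C_mul]
      simp
    apply mul_left_cancel₀ hk
    have h1 : ((k : R) + 1) * ((windowSum R b ^ (k + 1)) (stirlingPoly R n (k + 1))).eval (b * x) =
        ((windowSum R b ^ (k + 1)) (((k : R) + 1) • stirlingPoly R n (k + 1))).eval (b * x) := by
      rw [map_smul, eval_smul, smul_eq_mul]
    have h2 := congrArg (eval x) hG
    rw [eval_smul, smul_eq_mul, eval_sub, taylor_eval] at h2
    rw [h1, hG, pow_succ, Module.End.mul_apply, windowSum_taylor_one_sub, map_sub,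
      windowSum_pow_taylor, eval_sub, taylor_eval, ih, mul_left_comm, h2, mul_sub, ← ih (x + 1)]
    ring_nf

/-! ### Moments of functions on `ZMod p` -/

section Moments

variable {p : ℕ} [Fact p.Prime]

/-- The `j`-th moment of the function that a polynomial induces on `ZMod p`. -/
noncomputable def moment (j : ℕ) (f : (ZMod p)[X]) : ZMod p :=
  ∑ x : ZMod p, x ^ j * f.eval x

/-- In the binomial expansion every term except the top one is a multiple of a lower moment. -/
theorem sum_add_pow_mul_eval (j : ℕ) (a : ZMod p) (f : (ZMod p)[X])
    (hf : ∀ i < j, moment i f = 0) :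
    ∑ x : ZMod p, (x + a) ^ j * f.eval x = moment j f := by
  simp only [add_pow, Finset.sum_mul]
  rw [Finset.sum_comm, Finset.sum_range_succ, Finset.sum_eq_zero]
  · simp [moment]
  · intro i hi
    have h := hf i (Finset.mem_range.1 hi)
    have : ∑ x : ZMod p, x ^ i * a ^ (j - i) * (j.choose i : ZMod p) * f.eval x =
        a ^ (j - i) * (j.choose i : ZMod p) * moment i f := by
      rw [moment, Finset.mul_sum]
      exact Finset.sum_congr rfl fun x _ => by ring
    rw [this, h, mul_zero]

theorem moment_taylor (j : ℕ) (a : ZMod p) (f : (ZMod p)[X]) (hf : ∀ i < j, moment i f = 0) :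
    moment j (taylor a f) = moment j f := by
  rw [← sum_add_pow_mul_eval j (-a) f hf, moment]
  refine Fintype.sum_equiv (Equiv.addRight a) _ _ fun x => ?_
  simp [taylor_eval]

theorem moment_windowSum (b j : ℕ) (f : (ZMod p)[X]) (hf : ∀ i < j, moment i f = 0) :
    moment j (windowSum (ZMod p) b f) = b * moment j f := by
  have : moment j (windowSum (ZMod p) b f) =
      ∑ i ∈ Finset.range b, moment j (taylor (i : ZMod p) f) := by
    simp only [moment, windowSum_apply, eval_finsetSum, Finset.mul_sum]
    rw [Finset.sum_comm]
  simp only [this, moment_taylor j _ f hf]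
  simp

theorem moment_windowSum_pow (b k j : ℕ) (f : (ZMod p)[X]) (hf : ∀ i < j, moment i f = 0) :
    moment j ((windowSum (ZMod p) b ^ k) f) = b ^ k * moment j f := by
  induction k generalizing f with
  | zero => simp
  | succ k ih =>
    rw [pow_succ, Module.End.mul_apply, ih, moment_windowSum b j f hf, pow_succ, mul_assoc]
    intro i hi
    rw [moment_windowSum b i f fun l hl => hf l (hl.trans hi), hf i hi, mul_zero]

theorem eval_eq_of_moment_eq_zero (f : (ZMod p)[X]) (hf : ∀ j < p - 1, moment j f = 0)
    (y : ZMod p) : f.eval y = -moment (p - 1) f := by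
  -- By Fermat, 1 - (x - y)^{p-1} is the indicator function of y.
  have h1 : f.eval y = ∑ x : ZMod p, (1 - (x + -y) ^ (p - 1)) * f.eval x := by
    rw [Finset.sum_eq_single y]
    · simp [(Fact.out : p.Prime).one_lt, Nat.sub_eq_zero_iff_le]
    · intro x _ hx
      rw [ZMod.pow_card_sub_one_eq_one (by rwa [← sub_eq_add_neg, sub_ne_zero]), sub_self, zero_mul]
    · simp
  have h0 : ∑ x : ZMod p, f.eval x = 0 := by
    have := hf 0 (Nat.sub_pos_of_lt (Fact.out : p.Prime).one_lt)
    simpa [moment] using this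
  rw [h1]
  simp only [sub_mul, one_mul, Finset.sum_sub_distrib]
  rw [sum_add_pow_mul_eval _ _ _ hf, h0, zero_sub]

/-- A function on `ZMod p` with vanishing sum that satisfies the multiplication formulas is
constant. -/
theorem eval_eq_eval_of_multiplication {n k : ℕ} (hk : k ≤ n) (hp : p - 1 ∣ n - k)
    (f : (ZMod p)[X]) (h0 : moment 0 f = 0)
    (hT : ∀ (b : ℕ) (x : ZMod p),
      ((windowSum (ZMod p) b ^ k) f).eval (b * x) = b ^ n * f.eval x)
    (y z : ZMod p) : f.eval y = f.eval z := by
  suffices hf : ∀ j < p - 1, moment j f = 0 by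
    rw [eval_eq_of_moment_eq_zero f hf y, eval_eq_of_moment_eq_zero f hf z]
  intro j
  induction j using Nat.strong_induction_on with
  | _ j ih =>
    intro hj
    rcases Nat.eq_zero_or_pos j with rfl | hj0
    · exact h0
    obtain ⟨u, hu⟩ := IsCyclic.exists_generator (α := (ZMod p)ˣ)
    have hord : orderOf u = p - 1 := by
      rw [orderOf_eq_card_of_forall_mem_zpowers hu, Nat.card_eq_fintype_card,
        ZMod.card_units_eq_totient, Nat.totient_prime Fact.out]
    set b : ℕ := (u : ZMod p).val with hb
    have hbu : (b : ZMod p) = u := by simp [hb]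
    have h1 := moment_windowSum_pow b k j f fun i hi => ih i hi (hi.trans hj)
    have h2 : moment j ((windowSum (ZMod p) b ^ k) f) =
        (b : ZMod p) ^ j * (b : ZMod p) ^ n * moment j f := by
      rw [moment, moment, Finset.mul_sum]
      -- Substitute x ↦ bx in the moment, so that the multiplication formula applies.
      refine (Fintype.sum_equiv (Units.mulLeft u) _ _ fun x => ?_).symm
      rw [Units.mulLeft_apply, ← hbu, hT]
      ring
    have hbn : (b : ZMod p) ^ n = (b : ZMod p) ^ k := by
      obtain ⟨c, hc⟩ := hp
      obtain rfl : n = k + (p - 1) * c := by omega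
      rw [pow_add, pow_mul, ZMod.pow_card_sub_one_eq_one (by rw [hbu]; exact u.ne_zero), one_pow,
        mul_one]
    rw [h1, hbn, hbu] at h2
    have hj1 : (u : ZMod p) ^ j ≠ 1 := by
      intro h
      have : u ^ j = 1 := by ext; simpa using h
      have := Nat.le_of_dvd hj0 (orderOf_dvd_of_pow_eq_one this)
      omega
    have hk0 : (u : ZMod p) ^ k ≠ 0 := pow_ne_zero _ u.ne_zero
    have h3 : ((u : ZMod p) ^ j - 1) * ((u : ZMod p) ^ k * moment j f) = 0 := by
      linear_combination -h2
    rcases mul_eq_zero.1 h3 with h | h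
    · exact absurd (sub_eq_zero.1 h) hj1
    · exact (mul_eq_zero.1 h).resolve_left hk0

end Moments

/-! ### Averaging over a window of length `p` -/

theorem isUnit_natCast_padicInt {p : ℕ} [Fact p.Prime] {u : ℕ} (hu : ¬ p ∣ u) :
    IsUnit (u : ℤ_[p]) := by
  rw [PadicInt.isUnit_iff]
  refine le_antisymm (PadicInt.norm_le_one _) (not_lt.1 fun h => hu ?_)
  have h' : ‖((u : ℤ) : ℤ_[p])‖ < 1 := by simpa using h
  rw [PadicInt.norm_int_lt_one_iff_dvd] at h'
  exact_mod_cast h'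

/-- If v = ν_p(j+1), then p^v ≤ j+1 ≤ p^j, so p^j/(j+1) is p-integral. For j ≥ 1 the strict
inequality j+1 < p^j fails only at p = 2, j = 1. -/
theorem exists_padicInt_succ_mul_eq_pow (p : ℕ) [Fact p.Prime] (j : ℕ) :
    ∃ c : ℤ_[p], ((j : ℤ_[p]) + 1) * c = (p : ℤ_[p]) ^ j ∧ (j + 1 < p ^ j → (p : ℤ_[p]) ∣ c) := by
  have hp : p.Prime := Fact.out
  obtain ⟨v, u, hu, hvu⟩ := Nat.exists_eq_pow_mul_and_not_dvd j.succ_ne_zero p hp.ne_one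
  have hu0 : 0 < u := Nat.pos_of_ne_zero fun h => hu (h ▸ dvd_zero p)
  have hvj : p ^ v ≤ j + 1 := by
    rw [← Nat.succ_eq_add_one, hvu]; exact Nat.le_mul_of_pos_right _ hu0
  have hv : v ≤ j := by
    have h1 : j + 1 ≤ p ^ j := Nat.lt_pow_self hp.one_lt
    exact (Nat.pow_le_pow_iff_right hp.one_lt).1 (hvj.trans h1)
  obtain ⟨w, hw⟩ := isUnit_natCast_padicInt hu
  have hj : ((j : ℤ_[p]) + 1) = (p : ℤ_[p]) ^ v * w := by
    rw [hw]; exact_mod_cast congrArg (Nat.cast : ℕ → ℤ_[p]) hvu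
  refine ⟨(p : ℤ_[p]) ^ (j - v) * ((w⁻¹ : ℤ_[p]ˣ) : ℤ_[p]), ?_, fun hlt => ?_⟩
  · have h1 : (w : ℤ_[p]) * ((w⁻¹ : ℤ_[p]ˣ) : ℤ_[p]) = 1 := w.mul_inv
    have h2 : (p : ℤ_[p]) ^ v * (p : ℤ_[p]) ^ (j - v) = (p : ℤ_[p]) ^ j := by
      rw [← pow_add, Nat.add_sub_cancel' hv]
    rw [hj]
    linear_combination (p : ℤ_[p]) ^ v * (p : ℤ_[p]) ^ (j - v) * h1 + h2
  · have : v < j := (Nat.pow_lt_pow_iff_right hp.one_lt).1 (hvj.trans_lt hlt)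
    exact (dvd_pow_self _ (Nat.sub_ne_zero_of_lt this)).mul_right _

/-- The operator `∑ⱼ γⱼ D⁽ʲ⁾` with the Hasse derivatives `D⁽ʲ⁾`, `j < N`. -/
noncomputable def hasseSum {R : Type*} [CommRing R] (γ : ℕ → R) (N : ℕ) : R[X] →ₗ[R] R[X] :=
  ∑ j ∈ Finset.range N, γ j • hasseDeriv j

theorem hasseSum_apply {R : Type*} [CommRing R] (γ : ℕ → R) (N : ℕ) (f : R[X]) :
    hasseSum γ N f = ∑ j ∈ Finset.range N, γ j • hasseDeriv j f := by
  simp [hasseSum, LinearMap.sum_apply]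

/-- The operator is unitriangular: positive-order Hasse derivatives bring in only higher
coefficients, so divisibility descends from the top degree. -/
theorem dvd_coeff_of_dvd_coeff_hasseSum {R : Type*} [CommRing R] (γ : ℕ → R) (h0 : γ 0 = 1)
    (N : ℕ) (c : R) (f : R[X]) (h : ∀ i, c ∣ (hasseSum γ (N + 1) f).coeff i) (i : ℕ) :
    c ∣ f.coeff i := by
  suffices ∀ d i, f.natDegree < i + d → c ∣ f.coeff i from
    this (f.natDegree + 1) i (by omega)
  intro d
  induction d with
  | zero => intro i hi; rw [coeff_eq_zero_of_natDegree_lt (by simpa using hi)]; exact dvd_zero c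
  | succ d ih =>
    intro i hi
    have hi' := h i
    rw [hasseSum_apply, Finset.sum_range_succ', coeff_add, finsetSum_coeff] at hi'
    rw [h0, one_smul, hasseDeriv_zero'] at hi'
    refine (dvd_add_right (Finset.dvd_sum fun j _ => ?_)).1 hi'
    rw [coeff_smul, hasseDeriv_coeff, smul_eq_mul]
    exact ((ih (i + (j + 1)) (by omega)).mul_left _).mul_left _

theorem taylor_eq_sum_hasseDeriv {R : Type*} [CommRing R] [IsDomain R] [Infinite R] (c : R)
    (f : R[X]) (N : ℕ) (hN : f.natDegree < N) :
    taylor c f = ∑ j ∈ Finset.range N, c ^ j • hasseDeriv j f := by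
  refine Polynomial.funext fun x => ?_
  -- f(x + c) is symmetric in x and c; expanding in powers of c produces the Hasse derivatives at x.
  have h : (taylor c f).eval x = (taylor x f).eval c := by
    rw [taylor_eval, taylor_eval, add_comm]
  rw [h, eval_eq_sum_range' (n := N) (by rwa [natDegree_taylor]), eval_finsetSum]
  refine Finset.sum_congr rfl fun j _ => ?_
  rw [taylor_coeff, eval_smul, smul_eq_mul, mul_comm]

theorem mul_hasseSum_derivative {R : Type*} [CommRing R] [IsDomain R] [Infinite R] (c : R)
    (γ : ℕ → R) (hγ : ∀ j : ℕ, ((j : R) + 1) * γ j = c ^ j) (f : R[X]) (N : ℕ)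
    (hN : f.natDegree ≤ N) :
    c • hasseSum γ N (derivative f) = taylor c f - f := by
  rw [taylor_eq_sum_hasseDeriv c f (N + 1) (by omega), Finset.sum_range_succ', hasseSum_apply,
    Finset.smul_sum]
  simp only [pow_zero, one_smul, hasseDeriv_zero', add_sub_cancel_right]
  refine Finset.sum_congr rfl fun j _ => ?_
  have h := LinearMap.congr_fun (hasseDeriv_comp (R := R) j 1) f
  rw [LinearMap.comp_apply, hasseDeriv_one'] at h
  rw [h, LinearMap.smul_apply, Nat.choose_symm_add, Nat.choose_one_right, pow_succ, ← hγ j,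
    ← Nat.cast_smul_eq_nsmul R, smul_smul, smul_smul]
  congr 1
  push_cast
  ring

/-- Both sides times k+1 are G_{n+1,k}(x+p) - G_{n+1,k}(x): on the right the differences telescope,
on the left G_{n+1,k}' = (n+1)·G_{n,k} enters the Taylor expansion. -/
theorem hasseSum_stirlingPoly {R : Type*} [CommRing R] [IsDomain R] [CharZero R] (p : ℕ)
    (γ : ℕ → R) (hγ : ∀ j : ℕ, ((j : R) + 1) * γ j = (p : R) ^ j) (n k : ℕ) (r : R)
    (hr : ((k : R) + 1) * r = n + 1) :
    hasseSum γ (n + 2) ((p * r) • stirlingPoly R n k) =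
      windowSum R p (stirlingPoly R (n + 1) (k + 1)) := by
  have hk : ((k : R) + 1) ≠ 0 := by exact_mod_cast k.succ_ne_zero
  have hk' : ((k : R[X]) + 1) = C ((k : R) + 1) := by simp
  have hn' : ((n : R[X]) + 1) = C ((n : R) + 1) := by simp
  have h1 := mul_hasseSum_derivative (p : R) γ hγ (stirlingPoly R (n + 1) k) (n + 2)
    ((natDegree_stirlingPoly_le _ _).trans (by omega))
  have h2 := succ_mul_stirlingPoly_succ (R := R) (n + 1) k
  rw [derivative_stirlingPoly_succ, hn', ← smul_eq_C_mul, ← hr, ← windowSum_taylor_one_sub, ← h2,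
    hk', ← smul_eq_C_mul, map_smul, map_smul, smul_smul] at h1
  apply smul_right_injective _ hk
  simp only
  rw [← h1, map_smul, smul_smul]
  congr 1
  ring

/-! ### Vanishing of the sum over a complete residue system -/

theorem sum_range_eval_add (p : ℕ) [Fact p.Prime] (c : ZMod p) (f : (ZMod p)[X]) :
    (windowSum (ZMod p) p f).eval c = moment 0 f := by
  rw [← moment_taylor 0 c f (by simp)]
  simp only [moment, windowSum_apply, eval_finsetSum, taylor_eval, pow_zero, one_mul]
  refine Finset.sum_nbij' (fun i : ℕ => (i : ZMod p)) (fun x => x.val) ?_ ?_ ?_ ?_ ?_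
  · simp
  · intro x _; simpa using ZMod.val_lt x
  · intro i hi; exact ZMod.val_cast_of_lt (Finset.mem_range.1 hi)
  · simp
  · intro i _; rw [add_comm]

theorem derivative_derivative_zmod_two (f : (ZMod 2)[X]) : derivative (derivative f) = 0 := by
  have h := congrFun (factorial_smul_hasseDeriv (R := ZMod 2) (k := 2)) f
  have h2 : (2 : ℕ) • hasseDeriv 2 f = 0 := by
    rw [two_nsmul]; exact CharTwo.add_self_eq_zero _
  simpa [h2] using h.symm

/-- The case p = 2, k + 1 = 2l. Second derivatives vanish and translation by 1 is an involution, so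
differentiating the relations forces F' = 0 for either value of l. -/
theorem add_derivative_eval_one_eq_zero (F P : (ZMod 2)[X]) (l : ZMod 2)
    (hX : X * derivative F + l • taylor 1 P = 0)
    (hL : P + derivative P = F + taylor 1 F) (hP : P.eval 1 = 0) :
    (P + derivative P).eval 1 = 0 := by
  have ht : ∀ f : (ZMod 2)[X], derivative (taylor 1 f) = taylor 1 (derivative f) := fun f => by
    simp [taylor_apply, derivative_comp]
  have hdL : derivative P = derivative F + taylor 1 (derivative F) := by
    have := congrArg derivative hL
    rwa [derivative_add, derivative_derivative_zmod_two, add_zero, derivative_add, ht] at this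
  have h2 : (2 : (ZMod 2)[X]) = 0 := CharTwo.two_eq_zero
  have hl : ∀ l : ZMod 2, l = 0 ∨ l = 1 := by decide
  obtain rfl | rfl := hl l
  · rw [zero_smul, add_zero] at hX
    have hF : derivative F = 0 := (mul_eq_zero.1 hX).resolve_left X_ne_zero
    rw [hdL, hF, map_zero, add_zero, add_zero, hP]
  · rw [one_smul] at hX
    have hEP : taylor 1 P = X * derivative F := by
      linear_combination hX - X * derivative F * h2
    have hEP' : taylor 1 (derivative P) = derivative F := by
      have := congrArg derivative hEP
      rwa [ht, derivative_mul, derivative_derivative_zmod_two, mul_zero, add_zero, derivative_X,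
        one_mul] at this
    have hEE : taylor (1 : ZMod 2) (taylor 1 F) = F := by
      rw [taylor_taylor, CharTwo.add_self_eq_zero, taylor_zero]
    have h1 : (X + 1) * derivative F = taylor 1 F + F := by
      have := congrArg (taylor 1) hL
      rw [map_add, map_add, hEE, hEP, hEP'] at this
      linear_combination this
    have hF : derivative F = 0 := by
      have := congrArg derivative h1
      rw [derivative_mul, derivative_derivative_zmod_two, derivative_add, derivative_add, ht] at this
      simp only [derivative_X, derivative_one, add_zero, one_mul, mul_zero] at this
      have h3 : taylor (1 : ZMod 2) (derivative F) = 0 := by linear_combination -this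
      exact (taylor_eq_zero _ _).1 h3
    rw [hF, mul_zero, taylor_eq_zero] at hEP
    simp [hEP]

theorem map_hasseSum {R S : Type*} [CommRing R] [CommRing S] (φ : R →+* S) (γ : ℕ → R) (N : ℕ)
    (f : R[X]) : (hasseSum γ N f).map φ = hasseSum (fun j => φ (γ j)) N (f.map φ) := by
  rw [hasseSum_apply, hasseSum_apply, Polynomial.map_sum]
  refine Finset.sum_congr rfl fun j _ => ?_
  ext i
  simp [hasseDeriv_coeff]

theorem toZMod_eq_zero_of_dvd {p : ℕ} [Fact p.Prime] {x : ℤ_[p]} (h : (p : ℤ_[p]) ∣ x) :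
    PadicInt.toZMod x = 0 := by
  obtain ⟨y, rfl⟩ := h
  simp

theorem moment_zero_eq_zero {p : ℕ} [Fact p.Prime] (n k A : ℕ) (r : ℤ_[p])
    (hr : ((k : ℤ_[p]) + 1) * r = n + 1) (F : ℤ_[p][X])
    (hF : stirlingPoly ℤ_[p] (n + 1) (k + 1) = (p : ℤ_[p]) ^ A • F) :
    moment 0 (F.map PadicInt.toZMod) = 0 := by
  have hp : p.Prime := Fact.out
  have hpA : (p : ℤ_[p]) ^ A ≠ 0 := pow_ne_zero _ (by exact_mod_cast hp.ne_zero)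
  choose γ hγ hγp using exists_padicInt_succ_mul_eq_pow p
  have h0 : γ 0 = 1 := by simpa using hγ 0
  have hW := hasseSum_stirlingPoly p γ hγ n k r hr
  rw [hF, (windowSum ℤ_[p] p).map_smul] at hW
  -- Divisibility by p^A passes back through the unitriangular operator.
  obtain ⟨P, hP⟩ : ∃ P, (p * r) • stirlingPoly ℤ_[p] n k = (p : ℤ_[p]) ^ A • P := by
    have := dvd_coeff_of_dvd_coeff_hasseSum γ h0 (n + 1) ((p : ℤ_[p]) ^ A) _
      (fun i => by rw [hW, coeff_smul]; exact Dvd.intro _ rfl)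
    obtain ⟨P, hP⟩ := (C_dvd_iff_dvd_coeff _ _).2 this
    exact ⟨P, by rw [hP, smul_eq_C_mul]⟩
  rw [hP, map_smul] at hW
  have hL : hasseSum γ (n + 2) P = windowSum ℤ_[p] p F := smul_right_injective _ hpA hW
  -- G_{n,k}(1) and G_{n+1,k+1}(0) are both S(n+1,k+1).
  have hP1 : P.eval 1 = p * r * F.eval 0 := by
    have h1 := congrArg (eval 1) hP
    have h2 := congrArg (eval 0) hF
    rw [eval_smul, eval_smul, eval_one_stirlingPoly, ← eval_zero_stirlingPoly (R := ℤ_[p]), h2,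
      eval_smul] at h1
    simp only [smul_eq_mul] at h1
    apply mul_left_cancel₀ hpA
    linear_combination -h1
  set φ := PadicInt.toZMod (p := p)
  have hP1' : (P.map φ).eval 1 = 0 := by
    rw [← map_one φ, eval_map_apply, hP1]
    simp
  have hL' : hasseSum (fun j => φ (γ j)) (n + 2) (P.map φ) = windowSum (ZMod p) p (F.map φ) := by
    have := congrArg (Polynomial.map φ) hL
    have hw := map_windowSum_pow φ p 1 F
    rw [pow_one, pow_one] at hw
    rwa [map_hasseSum, hw] at this
  rw [← sum_range_eval_add p 1, ← hL', hasseSum_apply, Finset.sum_range_succ',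
    Finset.sum_range_succ']
  have hj : ∀ j, φ (γ (j + 1 + 1)) = 0 := fun j => toZMod_eq_zero_of_dvd <| hγp _ <| by
    have h1 : j + 1 < 2 ^ (j + 1) := Nat.lt_pow_self one_lt_two
    have h2 : 2 ^ (j + 1 + 1) ≤ p ^ (j + 1 + 1) := Nat.pow_le_pow_left hp.two_le _
    rw [pow_succ] at h2
    omega
  rw [Finset.sum_eq_zero fun j _ => by rw [hj, zero_smul], zero_add, h0, map_one, one_smul,
    hasseDeriv_zero', zero_add, hasseDeriv_one']
  by_cases hp2 : p = 2
  · subst hp2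
    have h1 : γ 1 = 1 := by
      have := hγ 1
      have h2 : (2 : ℤ_[2]) ≠ 0 := two_ne_zero
      apply mul_left_cancel₀ h2
      push_cast at this
      linear_combination this
    have hS : windowSum (ZMod 2) 2 (F.map φ) = F.map φ + taylor 1 (F.map φ) := by
      simp [windowSum_apply, Finset.sum_range_succ]
    rw [hS, hasseSum_apply, Finset.sum_range_succ', Finset.sum_range_succ',
      Finset.sum_eq_zero fun j _ => by rw [hj, zero_smul], zero_add, h0, h1, map_one, one_smul,
      one_smul, hasseDeriv_zero', zero_add, hasseDeriv_one', add_comm] at hL'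
    have hr' : C ((k : ℤ_[2]) + 1) * C r = C ((n : ℤ_[2]) + 1) := by rw [← C_mul, hr]
    -- The recursion for G_{n+1,k+1} times 2(n+1), with G_{n,k+1} and G_{n,k} rewritten through F'
    -- and P. It controls P' mod 2, which survives because γ₁ = 1.
    have hXF : C ((2 : ℤ_[2]) * (n + 1)) * F =
        C 2 * (X * derivative F) + C ((k : ℤ_[2]) + 1) * taylor 1 P := by
      have hd := congrArg derivative hF
      have hrec := stirlingPoly_succ_succ (R := ℤ_[2]) n k
      have hP' := congrArg (taylor 1) hP
      rw [derivative_stirlingPoly_succ, derivative_smul] at hd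
      rw [map_smul, map_smul] at hP'
      simp only [smul_eq_C_mul] at hd hF hP'
      have hn' : ((n : ℤ_[2][X]) + 1) = C ((n : ℤ_[2]) + 1) := by simp
      rw [hn'] at hd
      rw [hF] at hrec
      have hA : C ((2 : ℤ_[2]) ^ A) ≠ 0 := by simp
      apply mul_left_cancel₀ hA
      simp only [C_mul, Nat.cast_ofNat] at *
      linear_combination C 2 * C ((n : ℤ_[2]) + 1) * hrec + C 2 * X * hd +
        C ((k : ℤ_[2]) + 1) * hP' - C 2 * taylor 1 (stirlingPoly ℤ_[2] n k) * hr'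
    rw [h1, map_one, one_smul, add_comm]
    have hφ2 : φ 2 = 0 := toZMod_eq_zero_of_dvd (by simp)
    -- If k+1 is odd, `hXF` mod 2 already gives P = 0; if it is even, a factor 2 must be cancelled
    -- before reducing.
    rcases Nat.even_or_odd' (k + 1) with ⟨l, hl | hl⟩
    · have hk : (k : ℤ_[2]) + 1 = 2 * l := by exact_mod_cast congrArg (Nat.cast : ℕ → ℤ_[2]) hl
      have h3 : C (2 * (l : ℤ_[2]) * r) * F =
          X * derivative F + C (l : ℤ_[2]) * taylor 1 P := by
        have hA : C (2 : ℤ_[2]) ≠ 0 := by simp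
        apply mul_left_cancel₀ hA
        rw [hk] at hXF hr
        rw [← hr] at hXF
        simp only [C_mul] at *
        linear_combination hXF
      have h4 := congrArg (Polynomial.map φ) h3
      rw [Polynomial.map_mul, Polynomial.map_add, Polynomial.map_mul, Polynomial.map_mul,
        map_taylor, map_C, map_C, map_X, map_mul φ, map_mul φ, hφ2, zero_mul, zero_mul, C_0,
        zero_mul, map_one, map_natCast φ, ← derivative_map] at h4
      refine add_derivative_eval_one_eq_zero (F.map φ) (P.map φ) l ?_ ?_ hP1'
      · rw [smul_eq_C_mul, ← h4]
      · exact hL'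
    · have hk : (k : ℤ_[2]) + 1 = 2 * l + 1 := by
        exact_mod_cast congrArg (Nat.cast : ℕ → ℤ_[2]) hl
      have h4 := congrArg (Polynomial.map φ) hXF
      rw [hk] at h4
      simp at h4
      rw [hφ2, C_0, zero_mul, zero_mul, zero_mul, zero_mul, zero_add, zero_add, one_mul] at h4
      rw [(taylor_eq_zero _ _).1 h4.symm]
      simp
  · have h1 : φ (γ 1) = 0 := toZMod_eq_zero_of_dvd <| hγp _ <| by
      have := hp.two_le
      rw [pow_one]; omega
    rw [h1, zero_smul, zero_add, hP1']

/-! ### The congruence S(n+1,k+1) ≡ S(n,k) mod p^{A+1} -/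

theorem exists_padicInt_mul_eq {p : ℕ} [Fact p.Prime] {n k : ℕ} (hk : k ≠ 0)
    (h : emultiplicity p k ≤ emultiplicity p n) : ∃ r : ℤ_[p], (k : ℤ_[p]) * r = n := by
  obtain ⟨v, u, hu, rfl⟩ :=
    Nat.exists_eq_pow_mul_and_not_dvd hk p (Fact.out : p.Prime).ne_one
  obtain ⟨m, rfl⟩ : p ^ v ∣ n := pow_dvd_iff_le_emultiplicity.2
    ((pow_dvd_iff_le_emultiplicity.1 (dvd_mul_right (p ^ v) u)).trans h)
  obtain ⟨w, hw⟩ := isUnit_natCast_padicInt hu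
  refine ⟨m * ((w⁻¹ : ℤ_[p]ˣ) : ℤ_[p]), ?_⟩
  have h1 : (w : ℤ_[p]) * ((w⁻¹ : ℤ_[p]ˣ) : ℤ_[p]) = 1 := w.mul_inv
  push_cast
  rw [← hw]
  linear_combination (p : ℤ_[p]) ^ v * m * h1

theorem pow_succ_dvd_stirlingSecond_sub {p : ℕ} [Fact p.Prime] {n k : ℕ} (hkn : k ≤ n)
    (hv : emultiplicity p k ≤ emultiplicity p n) (hp : p - 1 ∣ n - k) (A : ℕ)
    (hA : ∀ i, (p : ℤ) ^ A ∣ (stirlingPoly ℤ n k).coeff i) :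
    (p : ℤ) ^ (A + 1) ∣
      (Nat.stirlingSecond (n + 1) (k + 1) : ℤ) - (Nat.stirlingSecond n k : ℤ) := by
  have hprime : p.Prime := Fact.out
  rcases k with _ | k
  -- ν_p(0) = ∞, so k = 0 forces n = 0.
  · obtain rfl : n = 0 := by
      by_contra hn
      have hfin : FiniteMultiplicity p n :=
        Nat.finiteMultiplicity_iff.2 ⟨hprime.ne_one, Nat.pos_of_ne_zero hn⟩
      rw [emultiplicity_zero, top_le_iff] at hv
      exact finiteMultiplicity_iff_emultiplicity_ne_top.1 hfin hv
    simp [Nat.stirlingSecond_self]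
  obtain ⟨n, rfl⟩ : ∃ m, n = m + 1 := ⟨n - 1, by omega⟩
  obtain ⟨r, hr⟩ := exists_padicInt_mul_eq k.succ_ne_zero hv
  push_cast at hr
  obtain ⟨F, hF⟩ := (C_dvd_iff_dvd_coeff _ _).2 hA
  have hpA : (p : ℤ_[p]) ^ A ≠ 0 := pow_ne_zero _ (by exact_mod_cast hprime.ne_zero)
  have hFp : stirlingPoly ℤ_[p] (n + 1) (k + 1) =
      (p : ℤ_[p]) ^ A • F.map (Int.castRingHom ℤ_[p]) := by
    rw [← map_stirlingPoly (Int.castRingHom ℤ_[p]), hF, smul_eq_C_mul]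
    simp
  have hcomp : (F.map (Int.castRingHom ℤ_[p])).map PadicInt.toZMod =
      F.map (Int.castRingHom (ZMod p)) := by
    rw [Polynomial.map_map]
    congr 1
    exact RingHom.ext_int _ _
  have h0 := moment_zero_eq_zero n k A r hr _ hFp
  have hT : ∀ (b : ℕ) (x : ZMod p),
      ((windowSum (ZMod p) b ^ (k + 1)) (F.map (Int.castRingHom (ZMod p)))).eval (b * x) =
        b ^ (n + 1) * (F.map (Int.castRingHom (ZMod p))).eval x := by
    intro b x
    -- The formula is proved over ℤ_p, where p^A can be cancelled, and only then reduced mod p.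
    obtain ⟨x, rfl⟩ := ZMod.ringHom_surjective (PadicInt.toZMod (p := p)) x
    have h := eval_windowSum_pow_stirlingPoly (R := ℤ_[p]) b (n + 1) (k + 1) x
    rw [hFp, (windowSum ℤ_[p] b ^ (k + 1)).map_smul, eval_smul, eval_smul, smul_eq_mul,
      smul_eq_mul, mul_left_comm] at h
    have h' := congrArg PadicInt.toZMod (mul_left_cancel₀ hpA h)
    rw [← eval_map_apply, map_windowSum_pow, map_mul, map_mul, ← eval_map_apply, hcomp] at h'
    simpa using h'
  rw [hcomp] at h0
  have h1 := eval_eq_eval_of_multiplication hkn hp _ h0 hT 1 0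
  have hdvd : (p : ℤ) ∣ F.eval 1 - F.eval 0 := by
    rw [← ZMod.intCast_zmod_eq_zero_iff_dvd]
    have e1 := eval_map_apply (Int.castRingHom (ZMod p)) 1 (p := F)
    have e0 := eval_map_apply (Int.castRingHom (ZMod p)) 0 (p := F)
    rw [map_one] at e1
    rw [map_zero] at e0
    rw [e1, e0] at h1
    simpa [sub_eq_zero] using h1
  have g1 := eval_one_stirlingPoly (R := ℤ) (n + 1) (k + 1)
  have g0 := eval_zero_stirlingPoly (R := ℤ) (n + 1) (k + 1)
  rw [← g1, ← g0, hF, eval_mul, eval_mul, eval_C, eval_C, ← mul_sub, pow_succ]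
  exact mul_dvd_mul_left _ hdvd

/-! ### The estimate -/

theorem padicValNat_den_le_maxPole (p : ℕ) (f : ℚ[X]) (i : ℕ) :
    padicValNat p (f.coeff i).den ≤ maxPole p f := by
  by_cases h : i ∈ f.support
  · exact Finset.le_sup (f := fun i => padicValNat p (f.coeff i).den) h
  · simp [notMem_support_iff.1 h]

theorem choose_mul_coeff_higherBernoulli {n k : ℕ} (hk : k ≤ n) (i : ℕ) :
    (n.choose k : ℚ) * (higherBernoulli (-(k : ℤ)) (n - k)).coeff i =
      ((stirlingPoly ℤ n k).coeff i : ℚ) := by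
  have h := congrArg (fun f => coeff f i) (choose_mul_higherBernoulli hk)
  rw [← map_stirlingPoly (Int.castRingHom ℚ)] at h
  simp only [← C_eq_natCast, coeff_C_mul, coeff_map] at h
  exact h

theorem den_coeff_higherBernoulli_dvd {n k : ℕ} (hk : k ≤ n) (i : ℕ) :
    ((higherBernoulli (-(k : ℤ)) (n - k)).coeff i).den ∣ n.choose k := by
  have hC : (n.choose k : ℚ) ≠ 0 := by exact_mod_cast (Nat.choose_pos hk).ne'
  have h : (higherBernoulli (-(k : ℤ)) (n - k)).coeff i =
      (((stirlingPoly ℤ n k).coeff i : ℤ) : ℚ) / ((n.choose k : ℤ) : ℚ) := by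
    rw [eq_div_iff (by exact_mod_cast hC), ← choose_mul_coeff_higherBernoulli hk, mul_comm]
    simp
  have := Rat.den_dvd ((stirlingPoly ℤ n k).coeff i) (n.choose k)
  rw [h]
  exact_mod_cast this

theorem maxPole_higherBernoulli_le {p : ℕ} [Fact p.Prime] {n k : ℕ} (hk : k ≤ n) :
    maxPole p (higherBernoulli (-(k : ℤ)) (n - k)) ≤ padicValNat p (n.choose k) :=
  Finset.sup_le fun i _ => (padicValNat_dvd_iff_le (Nat.choose_pos hk).ne').1
    (pow_padicValNat_dvd.trans (den_coeff_higherBernoulli_dvd hk i))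

/-- Each coefficient is binom(n,k) times a rational whose denominator has p-part at most p^M. -/
theorem pow_dvd_coeff_stirlingPoly {p : ℕ} [Fact p.Prime] {n k : ℕ} (hk : k ≤ n) (i : ℕ) :
    (p : ℤ) ^ (padicValNat p (n.choose k) - maxPole p (higherBernoulli (-(k : ℤ)) (n - k))) ∣
      (stirlingPoly ℤ n k).coeff i := by
  have hprime : p.Prime := Fact.out
  set q := (higherBernoulli (-(k : ℤ)) (n - k)).coeff i with hq
  have hM := padicValNat_den_le_maxPole p (higherBernoulli (-(k : ℤ)) (n - k)) i
  have hsC : padicValNat p q.den ≤ padicValNat p (n.choose k) :=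
    hM.trans (maxPole_higherBernoulli_le hk)
  rw [← hq] at hM
  have hmul : (n.choose k : ℤ) * q.num = (stirlingPoly ℤ n k).coeff i * q.den := by
    have h := choose_mul_coeff_higherBernoulli hk i
    rw [← hq] at h
    have h2 := Rat.mul_den_eq_num q
    have : (n.choose k : ℚ) * q.num = ((stirlingPoly ℤ n k).coeff i : ℚ) * q.den := by
      rw [← h, ← h2, mul_assoc]
    exact_mod_cast this
  obtain ⟨v, d, hd, hvd⟩ :=
    Nat.exists_eq_pow_mul_and_not_dvd q.den_nz p hprime.ne_one
  have hv : padicValNat p q.den = v := by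
    rw [hvd, padicValNat.mul (pow_ne_zero _ hprime.ne_zero) (by rintro rfl; exact hd (dvd_zero p)),
      padicValNat.prime_pow, padicValNat.eq_zero_of_not_dvd hd, add_zero]
  rw [hv] at hM hsC
  refine (pow_dvd_pow _ (Nat.sub_le_sub_left hM _)).trans ?_
  have h1 : (p : ℤ) ^ padicValNat p (n.choose k) ∣ (stirlingPoly ℤ n k).coeff i * q.den := by
    rw [← hmul]
    exact Dvd.dvd.mul_right (by exact_mod_cast pow_padicValNat_dvd) _
  rw [hvd, ← Nat.add_sub_cancel' hsC, pow_add] at h1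
  push_cast at h1
  rw [mul_left_comm] at h1
  have h2 := (mul_dvd_mul_iff_left
    (pow_ne_zero v (by exact_mod_cast hprime.ne_zero : (p : ℤ) ≠ 0))).1 h1
  refine IsCoprime.dvd_of_dvd_mul_right (IsCoprime.pow_left ?_) h2
  exact Nat.isCoprime_iff_coprime.2 ((Nat.Prime.coprime_iff_not_dvd hprime).2 hd)

theorem samzEstimate_succ_succ (p n k : ℕ) :
    samzEstimate p (n + 1) (k + 1) = amzEstimate p n k := by
  simp [samzEstimate, amzEstimate]

theorem amzEstimate_eq {p : ℕ} [Fact p.Prime] {n k : ℕ} (hk : k ≤ n) :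
    amzEstimate p n k = ((padicValNat p (n.choose k) -
      maxPole p (higherBernoulli (-(k : ℤ)) (n - k)) : ℕ) : ℤ) := by
  rw [amzEstimate, Nat.cast_sub (maxPole_higherBernoulli_le hk)]

/-- In this form the condition visibly depends only on a mod p^{A+1}. -/
theorem ne_zero_and_padicValNat_eq_iff {p : ℕ} [Fact p.Prime] (a A : ℕ) :
    (a ≠ 0 ∧ padicValNat p a = A) ↔ (p : ℤ) ^ A ∣ a ∧ ¬ (p : ℤ) ^ (A + 1) ∣ a := by
  norm_cast
  constructor
  · rintro ⟨h0, rfl⟩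
    exact ⟨pow_padicValNat_dvd, pow_succ_padicValNat_not_dvd h0⟩
  · rintro ⟨h1, h2⟩
    have h0 : a ≠ 0 := fun h => h2 (h ▸ dvd_zero _)
    rw [padicValNat_dvd_iff_le h0] at h1 h2
    exact ⟨h0, by omega⟩

theorem isAMZC_iff_isSAMZC {p : ℕ} [Fact p.Prime] {n k : ℕ} (hkn : k ≤ n)
    (hv : emultiplicity p k ≤ emultiplicity p n) (hp : p - 1 ∣ n - k) :
    IsAMZC p n k ↔ IsSAMZC p (n + 1) (k + 1) := by
  have h := pow_succ_dvd_stirlingSecond_sub hkn hv hp _ (pow_dvd_coeff_stirlingPoly hkn)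
  rw [IsAMZC, IsSAMZC, samzEstimate_succ_succ, amzEstimate_eq hkn, Nat.cast_inj, Nat.cast_inj,
    ne_zero_and_padicValNat_eq_iff, ne_zero_and_padicValNat_eq_iff]
  have h' := (pow_dvd_pow (p : ℤ) (Nat.le_succ _)).trans h
  rw [dvd_iff_dvd_of_dvd_sub h, dvd_iff_dvd_of_dvd_sub h']

theorem padicValNat_stirlingSecond_succ_succ {p : ℕ} [Fact p.Prime] {n k : ℕ} (hkn : k ≤ n)
    (hv : emultiplicity p k ≤ emultiplicity p n) (hp : p - 1 ∣ n - k) (h : IsAMZC p n k) :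
    padicValNat p (Nat.stirlingSecond (n + 1) (k + 1)) =
      padicValNat p (Nat.stirlingSecond n k) := by
  have h2 := ((isAMZC_iff_isSAMZC hkn hv hp).1 h).2
  rw [samzEstimate_succ_succ, ← h.2] at h2
  exact_mod_cast h2

end StirlingCases

theorem mainTheorem9 (p : ℕ) (hp : p.Prime) :
    (∀ n k : ℕ, k ≤ n → emultiplicity p k ≤ emultiplicity p n → p - 1 ∣ n - k →
      (StirlingCases.IsAMZC p n k ↔ StirlingCases.IsSAMZC p (n + 1) (k + 1)) ∧
      (StirlingCases.IsAMZC p n k →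
        padicValNat p (Nat.stirlingSecond (n + 1) (k + 1)) =
          padicValNat p (Nat.stirlingSecond n k))) ∧
    (∀ n k : ℕ, 1 ≤ k → k ≤ n →
      emultiplicity p (k - 1) ≤ emultiplicity p (n - 1) → p - 1 ∣ n - k →
      (StirlingCases.IsAMZC p (n - 1) (k - 1) ↔ StirlingCases.IsSAMZC p n k) ∧
      (StirlingCases.IsAMZC p (n - 1) (k - 1) →
        padicValNat p (Nat.stirlingSecond n k) =
          padicValNat p (Nat.stirlingSecond (n - 1) (k - 1)))) := by
  have : Fact p.Prime := ⟨hp⟩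
  have key : ∀ n k : ℕ, k ≤ n → emultiplicity p k ≤ emultiplicity p n → p - 1 ∣ n - k →
      (StirlingCases.IsAMZC p n k ↔ StirlingCases.IsSAMZC p (n + 1) (k + 1)) ∧
      (StirlingCases.IsAMZC p n k →
        padicValNat p (Nat.stirlingSecond (n + 1) (k + 1)) =
          padicValNat p (Nat.stirlingSecond n k)) := fun n k hkn hv hd =>
    ⟨StirlingCases.isAMZC_iff_isSAMZC hkn hv hd,
      StirlingCases.padicValNat_stirlingSecond_succ_succ hkn hv hd⟩
  refine ⟨key, fun n k hk hkn hv hd => ?_⟩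
  -- Part (b) is part (a) at (n-1, k-1).
  obtain ⟨k, rfl⟩ := Nat.exists_eq_add_of_le' hk
  obtain ⟨n, rfl⟩ := Nat.exists_eq_add_of_le' (hk.trans hkn)
  rw [Nat.add_sub_add_right] at hd
  exact key n k (by omega) hv hd
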